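/- For $\lambda\in\mathbb{R}$ let $e_\lambda(x)=e^{2\pi i\lambda x}$. A finite set $A\subset\mathbb{R}$ is called spectral if there is a set $\Lambda\subset\mathbb{R}$ such that the functions $e_\lambda$, $\lambda\in\Lambda$, form an orthogonal basis of $L^2(\mu_A)$, where $\mu_A$ is the counting measure on $A$. Let $N\in\{2,3,5\}$ and let $B\subset\mathbb{Z}$ be a set with $|B|=N$ and $0\in B$. Then $B$ is spectral if and only if there are an integer $k\ge 0$ and a complete set of residues $B_0\subset\mathbb{Z}$ modulo $N$ (a set containing exactly one element of each residue class modulo $N$) such that $B=N^kB_0=\{N^kb: b\in B_0\}$. -/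

import Mathlib

open MeasureTheory

noncomputable section

/-- The exponential function `e_l(x) = exp(2 π i l x)` on the real line. -/
def expFun (l x : ℝ) : ℂ := Complex.exp (2 * Real.pi * Complex.I * l * x)

theorem norm_expFun (l x : ℝ) : ‖expFun l x‖ = 1 := by
  have h : (2 * Real.pi * Complex.I * l * x : ℂ) = ((2 * Real.pi * l * x : ℝ) : ℂ) * Complex.I := by
    push_cast
    ring
  rw [expFun, h, Complex.norm_exp_ofReal_mul_I]

theorem continuous_expFun (l : ℝ) : Continuous (expFun l) := by
  unfold expFun
  fun_prop

theorem memLp_expFun (μ : Measure ℝ) [IsFiniteMeasure μ] (l : ℝ) : MemLp (expFun l) 2 μ :=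
  MemLp.of_bound (continuous_expFun l).aestronglyMeasurable 1
    (Filter.Eventually.of_forall fun x => (norm_expFun l x).le)

/-- The class of `e_l` in `L²(μ)`, for a finite Borel measure `μ` on the real line. -/
def expLp (μ : Measure ℝ) [IsFiniteMeasure μ] (l : ℝ) : Lp ℂ 2 μ :=
  (memLp_expFun μ l).toLp (expFun l)

/-- `S` is a spectrum for `μ`: the exponentials `e_l`, `l ∈ S`, form an orthogonal basis of
`L²(μ)`, that is, a family of nonzero, pairwise orthogonal vectors whose linear span is dense. -/
structure IsSpectrum (μ : Measure ℝ) [IsFiniteMeasure μ] (S : Set ℝ) : Prop where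
  ne_zero : ∀ l ∈ S, expLp μ l ≠ 0
  orthogonal : ∀ l ∈ S, ∀ m ∈ S, l ≠ m → inner ℂ (expLp μ l) (expLp μ m) = 0
  dense_span : (Submodule.span ℂ (expLp μ '' S)).topologicalClosure = ⊤

/-- A finite Borel measure on the real line is spectral if it has a spectrum. -/
def IsSpectralMeasure (μ : Measure ℝ) [IsFiniteMeasure μ] : Prop :=
  ∃ S : Set ℝ, IsSpectrum μ S

/-- The counting measure on a finite set of real numbers. -/
def countOn (A : Finset ℝ) : Measure ℝ := Measure.count.restrict (A : Set ℝ)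

instance isFiniteMeasure_countOn (A : Finset ℝ) : IsFiniteMeasure (countOn A) := by
  refine ⟨?_⟩
  rw [countOn, Measure.restrict_apply_univ, Measure.count_apply_finset]
  exact ENNReal.natCast_lt_top _

/-- A finite set of real numbers is spectral if the counting measure on it is spectral. -/
def IsSpectralFinset (A : Finset ℝ) : Prop := IsSpectralMeasure (countOn A)

/-- `C` is a complete set of residues modulo `N`: every residue class modulo `N` contains exactly
one element of `C`. -/
def IsCompleteResidues (N : ℕ) (C : Finset ℤ) : Prop :=
  ∀ r : ℤ, ∃! c : ℤ, c ∈ C ∧ c ≡ r [ZMOD N]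

end

/-! A spectrum of an `N`-point set gives an `N × N` complex Hadamard matrix of exponentials. For `N
= 2, 3, 5` such a matrix is rigid: the quotient of two rows consists of the `N`-th roots of unity up
to a common factor (`ratio_pow_and_injective`). This quotient is a single exponential `e_l`; since
`0 ∈ B`, it maps `B` onto the roots of unity, so `N l b` is an integer for `b ∈ B` and these
integers are distinct modulo `N`. Clearing the denominator of `N l` and splitting off its power of
`N` yields the residues (`exists_completeResidues`). Conversely, the frequencies `j / N ^ (k + 1)`
with `0 ≤ j < N` form a spectrum.

Order five is the hard case. A minor of size three leaves two columns, and this yields an identity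
between Vandermonde products of its even and odd terms. Together with its transpose it forces
coincidences among the even terms and among the odd terms (`vand_minor`). Hence row quotients are
injective, and a double count shows that products of entries of two consecutive quotients are
entries of the third; multiplying over a permutation makes the fifth powers equal. -/

/-- A square matrix of unimodular complex numbers with orthogonal rows and orthogonal columns. -/
structure IsComplexHadamard {ι κ : Type*} [Fintype ι] [Fintype κ] (H : ι → κ → ℂ) : Prop where
  norm_eq : ∀ i p, ‖H i p‖ = 1
  row : ∀ i k, i ≠ k → ∑ p, H k p / H i p = 0
  col : ∀ p q, p ≠ q → ∑ i, H i q / H i p = 0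

namespace IsComplexHadamard

section General

variable {ι κ : Type*} [Fintype ι] [Fintype κ] {H : ι → κ → ℂ}

theorem ne_zero (hH : IsComplexHadamard H) (i : ι) (p : κ) : H i p ≠ 0 := by
  intro h
  have := hH.norm_eq i p
  simp [h] at this

theorem transpose (hH : IsComplexHadamard H) : IsComplexHadamard (fun p i => H i p) :=
  ⟨fun p i => hH.norm_eq i p, hH.col, hH.row⟩

/-- Rescaling rows and columns so that row `i` and column `p` consist of ones. -/
theorem dephase (hH : IsComplexHadamard H) (i : ι) (p : κ) :
    IsComplexHadamard (fun m r => H m r * H i p / (H i r * H m p)) := by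
  have h0 := hH.ne_zero
  refine ⟨fun m r => by simp [hH.norm_eq], fun m k hmk => ?_, fun r s hrs => ?_⟩
  · have := hH.row m k hmk
    calc ∑ r, H k r * H i p / (H i r * H k p) / (H m r * H i p / (H i r * H m p))
        = ∑ r, (H m p / H k p) * (H k r / H m r) := by
          refine Finset.sum_congr rfl fun r _ => ?_
          have := h0 k r; have := h0 i p; have := h0 i r; have := h0 k p
          have := h0 m r; have := h0 m p
          field_simp
      _ = 0 := by rw [← Finset.mul_sum, this, mul_zero]
  · have := hH.col r s hrs
    calc ∑ m, H m s * H i p / (H i s * H m p) / (H m r * H i p / (H i r * H m p))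
        = ∑ m, (H i r / H i s) * (H m s / H m r) := by
          refine Finset.sum_congr rfl fun m _ => ?_
          have := h0 i s; have := h0 i p; have := h0 i r; have := h0 m s
          have := h0 m r; have := h0 m p
          field_simp
      _ = 0 := by rw [← Finset.mul_sum, this, mul_zero]

theorem reindex {ι' κ' : Type*} [Fintype ι'] [Fintype κ'] (hH : IsComplexHadamard H)
    (e : ι' ≃ ι) (f : κ' ≃ κ) : IsComplexHadamard (fun i p => H (e i) (f p)) := by
  refine ⟨fun i p => hH.norm_eq _ _, fun i k h => ?_, fun p q h => ?_⟩
  · rw [← hH.row (e i) (e k) (e.injective.ne h)]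
    exact f.sum_comp (fun p => H (e k) p / H (e i) p)
  · rw [← hH.col (f p) (f q) (f.injective.ne h)]
    exact e.sum_comp (fun i => H i (f q) / H i (f p))

end General

end IsComplexHadamard

/-! ### Identities for order five -/

theorem exists_complement_pair (p q r : Fin 5) (hpq : p ≠ q) (hqr : q ≠ r) (hpr : p ≠ r) :
    ∃ s t : Fin 5, (Finset.univ : Finset (Fin 5)) = {p, q, r, s, t} ∧
      p ∉ ({q, r, s, t} : Finset (Fin 5)) ∧ q ∉ ({r, s, t} : Finset (Fin 5)) ∧
      r ∉ ({s, t} : Finset (Fin 5)) ∧ s ≠ t := by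
  revert p q r
  decide

theorem sum_fin_five_eq (p q r : Fin 5) (hpq : p ≠ q) (hqr : q ≠ r) (hpr : p ≠ r) :
    ∃ s t : Fin 5, ∀ f : Fin 5 → ℂ, ∑ x, f x = f p + f q + f r + f s + f t := by
  obtain ⟨s, t, hu, h1, h2, h3, h4⟩ := exists_complement_pair p q r hpq hqr hpr
  refine ⟨s, t, fun f => ?_⟩
  rw [hu, Finset.sum_insert h1, Finset.sum_insert h2, Finset.sum_insert h3, Finset.sum_pair h4]
  ring

/-- If two of five unimodular numbers with vanishing sum are split off, then the product of the
partial sums for three families with product one is invariant under inversion. -/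
theorem prod_partial_sums_inv {u v w : Fin 5 → ℂ} (hu0 : ∀ x, u x ≠ 0) (hv0 : ∀ x, v x ≠ 0)
    (hw0 : ∀ x, w x ≠ 0) (huvw : ∀ x, u x * v x * w x = 1)
    (hu : ∑ x, u x = 0) (hv : ∑ x, v x = 0) (hw : ∑ x, w x = 0)
    (hu' : ∑ x, (u x)⁻¹ = 0) (hv' : ∑ x, (v x)⁻¹ = 0) (hw' : ∑ x, (w x)⁻¹ = 0)
    {p q r : Fin 5} (hpq : p ≠ q) (hqr : q ≠ r) (hpr : p ≠ r) :
    (u p + u q + u r) * (v p + v q + v r) * (w p + w q + w r) =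
      ((u p)⁻¹ + (u q)⁻¹ + (u r)⁻¹) * ((v p)⁻¹ + (v q)⁻¹ + (v r)⁻¹) *
        ((w p)⁻¹ + (w q)⁻¹ + (w r)⁻¹) := by
  obtain ⟨s, t, hs⟩ := sum_fin_five_eq p q r hpq hqr hpr
  rw [hs] at hu hv hw hu' hv' hw'
  have e1 : u p + u q + u r = -(u s + u t) := by linear_combination hu
  have e2 : v p + v q + v r = -(v s + v t) := by linear_combination hv
  have e3 : w p + w q + w r = -(w s + w t) := by linear_combination hw
  -- The inverses of two numbers add up to their sum divided by their product. The three products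
  -- that arise multiply to one by `huvw`.
  have aux : ∀ {a b : ℂ}, a ≠ 0 → b ≠ 0 → a⁻¹ + b⁻¹ = (a + b) * (a * b)⁻¹ := by
    intro a b ha hb
    field_simp
    ring
  have e1' : (u p)⁻¹ + (u q)⁻¹ + (u r)⁻¹ = -((u s + u t) * (u s * u t)⁻¹) := by
    rw [← aux (hu0 s) (hu0 t)]; linear_combination hu'
  have e2' : (v p)⁻¹ + (v q)⁻¹ + (v r)⁻¹ = -((v s + v t) * (v s * v t)⁻¹) := by
    rw [← aux (hv0 s) (hv0 t)]; linear_combination hv'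
  have e3' : (w p)⁻¹ + (w q)⁻¹ + (w r)⁻¹ = -((w s + w t) * (w s * w t)⁻¹) := by
    rw [← aux (hw0 s) (hw0 t)]; linear_combination hw'
  have hinv : (u s * u t)⁻¹ * (v s * v t)⁻¹ * (w s * w t)⁻¹ = 1 := by
    rw [← mul_inv, ← mul_inv, inv_eq_one]
    linear_combination (u t * v t * w t) * huvw s + huvw t
  rw [e1, e2, e3, e1', e2', e3']
  linear_combination ((u s + u t) * (v s + v t) * (w s + w t)) * hinv

/-- The Vandermonde product of three numbers. -/
def vand (x y z : ℂ) : ℂ := (x - y) * (y - z) * (z - x)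

theorem vand_eq_zero {x y z : ℂ} (h : vand x y z = 0) : x = y ∨ y = z ∨ z = x := by
  simpa [vand, sub_eq_zero, or_assoc] using h

/-- `a b c`, `d e f`, `g h k` are the rows of a `3 × 3` matrix. -/
theorem vand_add_vand_eq_zero {a b c d e f g h k : ℂ} (ha : a ≠ 0) (hb : b ≠ 0) (hc : c ≠ 0)
    (hd : d ≠ 0) (he : e ≠ 0) (hf : f ≠ 0) (hg : g ≠ 0) (hh : h ≠ 0) (hk : k ≠ 0)
    (H : (d / a + e / b + f / c) * (g / d + h / e + k / f) * (a / g + b / h + c / k) =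
      (a / d + b / e + c / f) * (d / g + e / h + f / k) * (g / a + h / b + k / c)) :
    vand (a * e * k) (b * f * g) (c * d * h) + vand (b * d * k) (a * f * h) (c * e * g) = 0 := by
  have key : (d / a + e / b + f / c) * (g / d + h / e + k / f) * (a / g + b / h + c / k) -
      (a / d + b / e + c / f) * (d / g + e / h + f / k) * (g / a + h / b + k / c) =
      (vand (a * e * k) (b * f * g) (c * d * h) + vand (b * d * k) (a * f * h) (c * e * g)) /
        (a * b * c * d * e * f * g * h * k) := by
    unfold vand
    field_simp
    ring
  rw [H, sub_self, eq_comm, div_eq_zero_iff] at key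
  rcases key with key | key
  · exact key
  · simp_all

/-! ### Orders two and three -/

/-- Eliminating one entry from the two relations leaves `x² + xy + y² = 0` for the other two. -/
theorem pow_three_eq_and_injective {v : Fin 3 → ℂ} (hv : ∀ x, v x ≠ 0) (h1 : ∑ x, v x = 0)
    (h2 : ∑ x, (v x)⁻¹ = 0) : (∀ q q', v q ^ 3 = v q' ^ 3) ∧ Function.Injective v := by
  rw [Fin.sum_univ_three] at h1 h2
  have a := hv 0
  have b := hv 1
  have c := hv 2
  field_simp at h2
  have e01 : v 0 ^ 2 + v 0 * v 1 + v 1 ^ 2 = 0 := by linear_combination (v 0 + v 1) * h1 - h2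
  have e02 : v 0 ^ 2 + v 0 * v 2 + v 2 ^ 2 = 0 := by linear_combination (v 0 + v 2) * h1 - h2
  have e12 : v 1 ^ 2 + v 1 * v 2 + v 2 ^ 2 = 0 := by linear_combination (v 1 + v 2) * h1 - h2
  have key : ∀ x y, x ≠ y → v x ^ 2 + v x * v y + v y ^ 2 = 0 := by
    intro x y hxy
    fin_cases x <;> fin_cases y
    · exact absurd rfl hxy
    · exact e01
    · exact e02
    · exact (by linear_combination e01 : v 1 ^ 2 + v 1 * v 0 + v 0 ^ 2 = 0)
    · exact absurd rfl hxy
    · exact e12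
    · exact (by linear_combination e02 : v 2 ^ 2 + v 2 * v 0 + v 0 ^ 2 = 0)
    · exact (by linear_combination e12 : v 2 ^ 2 + v 2 * v 1 + v 1 ^ 2 = 0)
    · exact absurd rfl hxy
  constructor
  · intro q q'
    rcases eq_or_ne q q' with rfl | h
    · rfl
    · linear_combination (v q - v q') * key q q' h
  · intro x y hxy
    by_contra h
    have h3 := key x y h
    rw [← hxy] at h3
    have : v x ^ 2 = 0 := by linear_combination h3 / 3
    exact hv x (pow_eq_zero_iff two_ne_zero |>.1 this)

theorem pow_two_eq_and_injective {v : Fin 2 → ℂ} (hv : ∀ x, v x ≠ 0) (h1 : ∑ x, v x = 0) :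
    (∀ q q', v q ^ 2 = v q' ^ 2) ∧ Function.Injective v := by
  rw [Fin.sum_univ_two] at h1
  have key : ∀ x y, x ≠ y → v x + v y = 0 := by
    intro x y hxy
    fin_cases x <;> fin_cases y
    · exact absurd rfl hxy
    · exact h1
    · exact (by linear_combination h1 : v 1 + v 0 = 0)
    · exact absurd rfl hxy
  constructor
  · intro q q'
    rcases eq_or_ne q q' with rfl | h
    · rfl
    · linear_combination (v q - v q') * key q q' h
  · intro x y hxy
    by_contra h
    have h3 := key x y h
    rw [← hxy] at h3
    exact hv x (by linear_combination h3 / 2)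

/-! ### Rigidity of Hadamard matrices of order five -/

namespace IsComplexHadamard

section Five

variable {H : Fin 5 → Fin 5 → ℂ}

theorem vand_add_vand (hH : IsComplexHadamard H) {i k m p q r : Fin 5} (hik : i ≠ k) (hkm : k ≠ m)
    (him : i ≠ m) (hpq : p ≠ q) (hqr : q ≠ r) (hpr : p ≠ r) :
    vand (H i p * H k q * H m r) (H i q * H k r * H m p) (H i r * H k p * H m q) +
      vand (H i q * H k p * H m r) (H i p * H k r * H m q) (H i r * H k q * H m p) = 0 := by
  have h0 := hH.ne_zero
  refine vand_add_vand_eq_zero (h0 _ _) (h0 _ _) (h0 _ _) (h0 _ _) (h0 _ _) (h0 _ _) (h0 _ _)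
    (h0 _ _) (h0 _ _) ?_
  have := prod_partial_sums_inv (u := fun x => H k x / H i x) (v := fun x => H m x / H k x)
    (w := fun x => H i x / H m x) (fun x => div_ne_zero (h0 _ _) (h0 _ _))
    (fun x => div_ne_zero (h0 _ _) (h0 _ _)) (fun x => div_ne_zero (h0 _ _) (h0 _ _))
    (fun x => by have := h0 i x; have := h0 k x; have := h0 m x; field_simp)
    (hH.row i k hik) (hH.row k m hkm) (hH.row m i him.symm)
    (by simpa only [inv_div] using hH.row k i hik.symm)
    (by simpa only [inv_div] using hH.row m k hkm.symm)
    (by simpa only [inv_div] using hH.row i m him) hpq hqr hpr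
  simpa only [inv_div] using this

/-- Among the three even terms of a `3 × 3` minor two coincide, and so for the odd terms. -/
theorem vand_minor (hH : IsComplexHadamard H) {i k m p q r : Fin 5} (hik : i ≠ k) (hkm : k ≠ m)
    (him : i ≠ m) (hpq : p ≠ q) (hqr : q ≠ r) (hpr : p ≠ r) :
    vand (H i p * H k q * H m r) (H i q * H k r * H m p) (H i r * H k p * H m q) = 0 ∧
      vand (H i q * H k p * H m r) (H i p * H k r * H m q) (H i r * H k q * H m p) = 0 := by
  have h1 := hH.vand_add_vand hik hkm him hpq hqr hpr
  -- Transposing swaps two even terms and fixes the odd ones, so only the even Vandermonde product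
  -- changes sign and both must vanish.
  have h2 := hH.transpose.vand_add_vand hpq hqr hpr hik hkm him
  simp only [vand] at h1 h2 ⊢
  constructor
  · linear_combination (h1 - h2) / 2
  · linear_combination (h1 + h2) / 2

theorem entry_ne_one_of_entry_eq_one (hH : IsComplexHadamard H) {i k p q : Fin 5} (hik : i ≠ k)
    (hpq : p ≠ q) (hi : ∀ x, H i x = 1) (hp : H k p = 1) (hq : H k q = 1) {r : Fin 5}
    (hrp : r ≠ p) (hrq : r ≠ q) : H k r ≠ 1 := by
  intro hr
  obtain ⟨s, t, hs⟩ := sum_fin_five_eq p q r hpq hrq.symm hrp.symm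
  have h1 := hH.row i k hik
  simp only [hi, div_one] at h1
  rw [hs, hp, hq, hr] at h1
  have h2 : H k s + H k t = -3 := by linear_combination h1
  have h3 := norm_add_le (H k s) (H k t)
  rw [h2, hH.norm_eq, hH.norm_eq] at h3
  norm_num at h3

/-- With `b = H k r`, `c = H m q`, `d = H m r`, the even terms are `d, b, c` and the odd ones `d,
bc, 1`. If `d` is `b` or `c`, then `d = bc` or `d = 1` would make `b` or `c` equal to one. -/
theorem entry_eq_or_inv (hH : IsComplexHadamard H) {i k m p q r : Fin 5} (hik : i ≠ k)
    (hkm : k ≠ m) (him : i ≠ m) (hpq : p ≠ q) (hqr : q ≠ r) (hpr : p ≠ r)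
    (hi : ∀ x, H i x = 1) (hp : ∀ x, H x p = 1) (hq : H k q = 1)
    (hb : H k r ≠ 1) (hc : H m q ≠ 1) : H k r = H m q ∨ H k r * H m q = 1 := by
  have h0 := hH.ne_zero
  obtain ⟨h1, h2⟩ := hH.vand_minor hik hkm him hpq hqr hpr
  simp only [hi, hp, hq, one_mul, mul_one] at h1 h2
  have hd := h0 m r
  rcases vand_eq_zero h1 with h1 | h1 | h1 <;> rcases vand_eq_zero h2 with h2 | h2 | h2
  all_goals grind

/-- Otherwise the other three entries of row `k` are each `c` or `c⁻¹`, where `c = H m q`. The row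
sum and the sum of inverses combine to `3c = -2`, which contradicts `|c| = 1`. -/
theorem entry_ne_one (hH : IsComplexHadamard H) {i k p q : Fin 5} (hik : i ≠ k) (hpq : p ≠ q)
    (hi : ∀ x, H i x = 1) (hp : ∀ x, H x p = 1) : H k q ≠ 1 := by
  intro hq
  have h0 := hH.ne_zero
  obtain ⟨m, him, hkm⟩ : ∃ m, i ≠ m ∧ k ≠ m := by
    clear hi hq
    revert i k; decide
  have hc : H m q ≠ 1 :=
    hH.transpose.entry_ne_one_of_entry_eq_one (i := p) (k := q) (p := i) (q := k) hpq hik hp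
      (hi q) hq him.symm hkm.symm
  obtain ⟨r, hpr, hqr⟩ : ∃ r, p ≠ r ∧ q ≠ r := by
    clear hp hq hc
    revert p q; decide
  obtain ⟨s, t, hu, h1, h2, h3, h4⟩ := exists_complement_pair p q r hpq hqr hpr
  have hsum : ∀ f : Fin 5 → ℂ, ∑ x, f x = f p + f q + f r + f s + f t := fun f => by
    rw [hu, Finset.sum_insert h1, Finset.sum_insert h2, Finset.sum_insert h3, Finset.sum_pair h4]
    ring
  simp only [Finset.mem_insert, Finset.mem_singleton, not_or] at h1 h2 h3
  have key : ∀ x, p ≠ x → q ≠ x → H k x = H m q ∨ H k x = (H m q)⁻¹ := fun x hx hx' => by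
    rcases hH.entry_eq_or_inv hik hkm him hpq hx' hx hi hp hq
      (hH.entry_ne_one_of_entry_eq_one hik hpq hi (hp k) hq hx.symm hx'.symm) hc with h | h
    · exact Or.inl h
    · exact Or.inr (eq_inv_of_mul_eq_one_left h)
  have e1 := hH.row i k hik
  have e2 := hH.row k i hik.symm
  simp only [hi, div_one, one_div] at e1 e2
  rw [hsum] at e1 e2
  have hm := hH.norm_eq m q
  have hcon : 3 * H m q = -2 → False := fun h => by
    have := congrArg norm h
    rw [norm_mul, hm] at this
    norm_num at this
  have hcon' : 3 * (H m q)⁻¹ = -2 → False := fun h => by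
    have := congrArg norm h
    rw [norm_mul, norm_inv, hm] at this
    norm_num at this
  rcases key r h1.2.1 h2.1 with hr | hr <;> rcases key s h1.2.2.1 h2.2.1 with hs | hs <;>
    rcases key t h1.2.2.2 h2.2.2 with ht | ht <;>
    simp only [hp, hq, hr, hs, ht, inv_one, inv_inv] at e1 e2 <;>
    first
    | exact hcon (by linear_combination e1)
    | exact hcon (by linear_combination 2 * e1 - e2)
    | exact hcon (by linear_combination 2 * e2 - e1)
    | exact hcon (by linear_combination e2)

theorem ratio_injective (hH : IsComplexHadamard H) {i k : Fin 5} (hik : i ≠ k) :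
    Function.Injective (fun x => H k x / H i x) := by
  intro p q hpq
  by_contra hne
  have h0 := hH.ne_zero
  have hd := hH.dephase i p
  refine hd.entry_ne_one hik hne (fun x => ?_) (fun x => ?_) (k := k) ?_
  · have := h0 i x; have := h0 i p
    field_simp
  · have := h0 i p; have := h0 x p
    field_simp
  · have := h0 i p; have := h0 k p; have := h0 i q
    simp only at hpq
    field_simp at hpq ⊢
    linear_combination -hpq

/-- In a Hadamard matrix of order five, the products of entries of `u = H k / H i` and
`v = H m / H k` are entries of `H m / H i`. -/
theorem exists_ratio_mul_ratio_mul_ratio_eq_one (hH : IsComplexHadamard H) {i k m : Fin 5}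
    (hik : i ≠ k) (hkm : k ≠ m) (him : i ≠ m) (p q : Fin 5) :
    ∃ r, H k p / H i p * (H m q / H k q) * (H i r / H m r) = 1 := by
  classical
  have h0 := hH.ne_zero
  set T : Fin 5 → Fin 5 → Fin 5 → ℂ := fun p q r =>
    H k p / H i p * (H m q / H k q) * (H i r / H m r) with hT
  have hTdiag : ∀ p, T p p p = 1 := fun p => by
    have := h0 i p; have := h0 k p; have := h0 m p
    simp only [hT]; field_simp
  rcases eq_or_ne p q with rfl | hpq
  · exact ⟨p, hTdiag p⟩
  -- Equality of two even terms of the minor says that `T` is one at some rotation of `(p, q, r)`.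
  have hcyc : ∀ p q r, p ≠ q → q ≠ r → p ≠ r → T p q r = 1 ∨ T q r p = 1 ∨ T r p q = 1 := by
    intro p q r hpq hqr hpr
    have h := (hH.vand_minor hik hkm him hpq hqr hpr).1
    have := h0 i p; have := h0 i q; have := h0 i r; have := h0 k p; have := h0 k q
    have := h0 k r; have := h0 m p; have := h0 m q; have := h0 m r
    rcases vand_eq_zero h with h | h | h
    · right; left
      simp only [hT]
      field_simp
      linear_combination h
    · right; right
      simp only [hT]
      field_simp
      linear_combination h
    · left
      simp only [hT]
      field_simp
      linear_combination h
  have huniq : ∀ p q r r', T p q r = 1 → T p q r' = 1 → r = r' := by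
    intro p q r r' h h'
    refine hH.ratio_injective him.symm ?_
    have : H k p / H i p * (H m q / H k q) ≠ 0 := by simp [h0]
    exact mul_left_cancel₀ this (h.trans h'.symm)
  -- Double count: each of the 60 ordered triples of distinct indices has a rotation with `T = 1`,
  -- so at least 20 triples satisfy it. Each of the 20 pairs `p ≠ q` admits at most one `r`, hence
  -- exactly one.
  set f : Fin 5 → Fin 5 → Fin 5 → ℕ := fun p q r =>
    if p ≠ q ∧ q ≠ r ∧ p ≠ r ∧ T p q r = 1 then 1 else 0 with hf
  have hle : ∀ p q, ∑ r, f p q r ≤ if p ≠ q then 1 else 0 := by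
    intro p q
    split_ifs with h
    · rw [hf, Finset.sum_boole]
      simp only [Nat.cast_id]
      refine Finset.card_le_one.2 fun r hr r' hr' => ?_
      simp only [Finset.mem_filter] at hr hr'
      exact huniq p q r r' hr.2.2.2.2 hr'.2.2.2.2
    · simp [hf, h]
  have hge : ∀ p q r, (if p ≠ q ∧ q ≠ r ∧ p ≠ r then 1 else 0) ≤
      f p q r + f q r p + f r p q := by
    intro p q r
    split_ifs with h
    · obtain ⟨a, b, c⟩ := h
      rcases hcyc p q r a b c with h | h | h <;>
        simp [hf, a, b, c, a.symm, b.symm, c.symm, h] <;> omega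
    · exact Nat.zero_le _
  have hrot : ∑ p, ∑ q, ∑ r, f q r p = ∑ p, ∑ q, ∑ r, f p q r := by
    rw [Finset.sum_comm]
    exact Finset.sum_congr rfl fun q _ => Finset.sum_comm
  have hrot' : ∑ p, ∑ q, ∑ r, f r p q = ∑ p, ∑ q, ∑ r, f p q r := by
    rw [← hrot, ← Finset.sum_comm]
    exact (Finset.sum_congr rfl fun q _ => Finset.sum_comm)
  have hcount : ∑ p : Fin 5, ∑ q : Fin 5, ∑ r : Fin 5,
      (if p ≠ q ∧ q ≠ r ∧ p ≠ r then 1 else 0) = 60 := by decide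
  have hcount' : ∑ p : Fin 5, ∑ q : Fin 5, (if p ≠ q then 1 else 0) = 20 := by decide
  have htotal : 60 ≤ 3 * ∑ p, ∑ q, ∑ r, f p q r := by
    rw [← hcount]
    calc _ ≤ ∑ p, ∑ q, ∑ r, (f p q r + f q r p + f r p q) :=
          Finset.sum_le_sum fun p _ => Finset.sum_le_sum fun q _ => Finset.sum_le_sum fun r _ =>
            hge p q r
      _ = _ := by
          simp only [Finset.sum_add_distrib]
          rw [hrot, hrot']
          ring
  have hpos : ∑ r, f p q r ≠ 0 := by
    intro hzero
    have : ∑ p, ∑ q, ∑ r, f p q r < 20 := by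
      rw [← hcount']
      refine Finset.sum_lt_sum (fun p _ => Finset.sum_le_sum fun q _ => hle p q)
        ⟨p, Finset.mem_univ _, Finset.sum_lt_sum (fun q _ => hle p q) ⟨q, Finset.mem_univ _, ?_⟩⟩
      rw [hzero]
      simp [hpq]
    omega
  obtain ⟨r, -, hr⟩ := Finset.exists_ne_zero_of_sum_ne_zero hpos
  refine ⟨r, ?_⟩
  by_contra h
  exact hr (if_neg fun h' => h h'.2.2.2)

/-- The ratios of two rows of a Hadamard matrix of order five have equal fifth powers. -/
theorem ratio_pow_five_eq (hH : IsComplexHadamard H) {k m : Fin 5} (hkm : k ≠ m) (q q' : Fin 5) :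
    (H m q / H k q) ^ 5 = (H m q' / H k q') ^ 5 := by
  have h0 := hH.ne_zero
  obtain ⟨i, hik, him⟩ : ∃ i, i ≠ k ∧ i ≠ m := by
    revert k m; decide
  have key : ∀ q, (∏ p, H k p / H i p) * (H m q / H k q) ^ 5 * ∏ r, H i r / H m r = 1 := by
    intro q
    -- For fixed `q` the map `p ↦ r` is a permutation, so the product of the relations over `p`
    -- determines the fifth power independently of `q`.
    choose σ hσ using fun p => hH.exists_ratio_mul_ratio_mul_ratio_eq_one hik hkm him p q
    have hinj : Function.Injective σ := by
      intro p p' h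
      have h1 := hσ p
      rw [h, ← hσ p'] at h1
      have hv : H m q / H k q ≠ 0 := div_ne_zero (h0 _ _) (h0 _ _)
      have hw : H i (σ p') / H m (σ p') ≠ 0 := div_ne_zero (h0 _ _) (h0 _ _)
      exact hH.ratio_injective hik (mul_right_cancel₀ hv (mul_right_cancel₀ hw h1))
    have hbij : Function.Bijective σ := Finite.injective_iff_bijective.1 hinj
    rw [← hbij.prod_comp (fun r => H i r / H m r)]
    calc _ = ∏ p, (H k p / H i p * (H m q / H k q) * (H i (σ p) / H m (σ p))) := by
          simp only [Finset.prod_mul_distrib, Finset.prod_const, Finset.card_univ,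
            Fintype.card_fin]
      _ = 1 := by simp only [hσ, Finset.prod_const_one]
  have hA : ∏ p, H k p / H i p ≠ 0 :=
    Finset.prod_ne_zero_iff.2 fun p _ => div_ne_zero (h0 _ _) (h0 _ _)
  have hC : ∏ r, H i r / H m r ≠ 0 :=
    Finset.prod_ne_zero_iff.2 fun p _ => div_ne_zero (h0 _ _) (h0 _ _)
  exact mul_left_cancel₀ hA (mul_right_cancel₀ hC ((key q).trans (key q').symm))

end Five

theorem ratio_pow_and_injective_three {H : Fin 3 → Fin 3 → ℂ} (hH : IsComplexHadamard H)
    {k m : Fin 3} (hkm : k ≠ m) :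
    (∀ q q', (H m q / H k q) ^ 3 = (H m q' / H k q') ^ 3) ∧
      Function.Injective (fun x => H m x / H k x) := by
  have h0 := hH.ne_zero
  refine pow_three_eq_and_injective (fun _ => div_ne_zero (h0 _ _) (h0 _ _)) (hH.row k m hkm) ?_
  simpa only [inv_div] using hH.row m k hkm.symm

theorem ratio_pow_and_injective_two {H : Fin 2 → Fin 2 → ℂ} (hH : IsComplexHadamard H)
    {k m : Fin 2} (hkm : k ≠ m) :
    (∀ q q', (H m q / H k q) ^ 2 = (H m q' / H k q') ^ 2) ∧
      Function.Injective (fun x => H m x / H k x) :=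
  pow_two_eq_and_injective (fun _ => div_ne_zero (hH.ne_zero _ _) (hH.ne_zero _ _))
    (hH.row k m hkm)

/-- In a Hadamard matrix of order two, three or five, the ratios of two rows are the roots of
unity of that order, up to a common factor. -/
theorem ratio_pow_and_injective {N : ℕ} (hN : N = 2 ∨ N = 3 ∨ N = 5) {H : Fin N → Fin N → ℂ}
    (hH : IsComplexHadamard H) {k m : Fin N} (hkm : k ≠ m) :
    (∀ q q', (H m q / H k q) ^ N = (H m q' / H k q') ^ N) ∧
      Function.Injective (fun x => H m x / H k x) := by
  rcases hN with rfl | rfl | rfl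
  · exact hH.ratio_pow_and_injective_two hkm
  · exact hH.ratio_pow_and_injective_three hkm
  · exact ⟨hH.ratio_pow_five_eq hkm, hH.ratio_injective hkm⟩

end IsComplexHadamard

/-- Row orthogonality provides a right inverse of a square matrix, which is also a left inverse. -/
theorem IsComplexHadamard.of_row {ι : Type*} [Fintype ι] {H : ι → ι → ℂ}
    (hnorm : ∀ i p, ‖H i p‖ = 1) (hrow : ∀ i k, i ≠ k → ∑ p, H k p / H i p = 0) :
    IsComplexHadamard H := by
  classical
  refine ⟨hnorm, hrow, fun p q hpq => ?_⟩
  have h0 : ∀ i p, H i p ≠ 0 := fun i p h => by simpa [h] using hnorm i p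
  have hn : (Fintype.card ι : ℂ) ≠ 0 :=
    Nat.cast_ne_zero.2 (Fintype.card_pos_iff.2 ⟨p⟩).ne'
  have hmul : Matrix.of H * Matrix.of (fun p i => (Fintype.card ι : ℂ)⁻¹ * (H i p)⁻¹) = 1 := by
    ext k i
    rw [Matrix.mul_apply, Matrix.one_apply]
    simp only [Matrix.of_apply]
    split_ifs with h
    · subst h
      have : ∀ x, H k x * ((Fintype.card ι : ℂ)⁻¹ * (H k x)⁻¹) = (Fintype.card ι : ℂ)⁻¹ :=
        fun x => by have := h0 k x; field_simp
      simp [this, hn]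
    · calc _ = (Fintype.card ι : ℂ)⁻¹ * ∑ p, H k p / H i p := by
            rw [Finset.mul_sum]
            exact Finset.sum_congr rfl fun x _ => by ring
        _ = 0 := by rw [hrow i k (Ne.symm h), mul_zero]
  rw [mul_eq_one_comm] at hmul
  have hmul' := congrFun (congrFun hmul p) q
  rw [Matrix.mul_apply, Matrix.one_apply_ne hpq] at hmul'
  simp only [Matrix.of_apply] at hmul'
  have : (Fintype.card ι : ℂ)⁻¹ * ∑ i, H i q / H i p = 0 := by
    rw [← hmul', Finset.mul_sum]
    exact Finset.sum_congr rfl fun x _ => by ring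
  exact (mul_eq_zero.1 this).resolve_left (inv_ne_zero hn)

/-! ### Spectra of finite sets and Hadamard matrices -/

theorem integral_countOn (A : Finset ℝ) (f : ℝ → ℂ) : ∫ x, f x ∂(countOn A) = ∑ a ∈ A, f a := by
  have hint : IntegrableOn f A Measure.count := by
    have : IntegrableOn f A (countOn A) := IntegrableOn.finset
    rwa [IntegrableOn, countOn, Measure.restrict_restrict A.measurableSet, Set.inter_self] at this
  rw [countOn, setIntegral_finset _ hint]
  simp [Measure.real]

theorem ae_countOn_iff (A : Finset ℝ) (p : ℝ → Prop) :
    (∀ᵐ x ∂(countOn A), p x) ↔ ∀ a ∈ A, p a := by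
  rw [countOn, ae_restrict_iff' A.measurableSet, Measure.ae_count_iff]
  rfl

theorem conj_expFun (l x : ℝ) : (starRingEnd ℂ) (expFun l x) = (expFun l x)⁻¹ :=
  (Complex.inv_eq_conj (norm_expFun l x)).symm

theorem inner_expLp_countOn (A : Finset ℝ) (l m : ℝ) :
    inner ℂ (expLp (countOn A) l) (expLp (countOn A) m) = ∑ a ∈ A, expFun m a / expFun l a := by
  rw [L2.inner_def, ← integral_countOn]
  refine integral_congr_ae ?_
  filter_upwards [(memLp_expFun (countOn A) l).coeFn_toLp,
    (memLp_expFun (countOn A) m).coeFn_toLp] with x hl hm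
  rw [expLp, expLp, hl, hm, RCLike.inner_apply, conj_expFun, div_eq_mul_inv]

/-- Evaluation at the points of `A`. -/
noncomputable def lpCountOnEval (A : Finset ℝ) : Lp ℂ 2 (countOn A) →ₗ[ℂ] (A → ℂ) where
  toFun f a := f a
  map_add' f g := by
    ext a
    exact (ae_countOn_iff A _).1 (Lp.coeFn_add f g) a a.2
  map_smul' c f := by
    ext a
    exact (ae_countOn_iff A _).1 (Lp.coeFn_smul c f) a a.2

theorem lpCountOnEval_bijective (A : Finset ℝ) : Function.Bijective (lpCountOnEval A) := by
  classical
  refine ⟨fun f g h => Lp.ext ((ae_countOn_iff A _).2 fun a ha => congrFun h ⟨a, ha⟩), fun g => ?_⟩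
  have hmem : MemLp (fun x => ∑ a : A, ({(a : ℝ)} : Set ℝ).indicator (fun _ => g a) x) 2
      (countOn A) :=
    memLp_finsetSum _ fun a _ => memLp_indicator_const 2 (measurableSet_singleton _) _
      (Or.inr (measure_ne_top _ _))
  refine ⟨hmem.toLp _, ?_⟩
  ext b
  refine ((ae_countOn_iff A _).1 hmem.coeFn_toLp b b.2).trans ?_
  beta_reduce
  rw [Finset.sum_eq_single b]
  · simp
  · intro a _ hab
    exact Set.indicator_of_notMem (fun h => hab (Subtype.ext (Set.mem_singleton_iff.1 h).symm)) _
  · simp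

/-- Functions in `L²` of the counting measure on `A` are functions on `A`. -/
noncomputable def lpCountOnEquiv (A : Finset ℝ) : Lp ℂ 2 (countOn A) ≃ₗ[ℂ] (A → ℂ) :=
  LinearEquiv.ofBijective (lpCountOnEval A) (lpCountOnEval_bijective A)

theorem finrank_lp_countOn (A : Finset ℝ) : Module.finrank ℂ (Lp ℂ 2 (countOn A)) = A.card := by
  rw [(lpCountOnEquiv A).finrank_eq, Module.finrank_fintype_fun_eq_card, Fintype.card_coe]

theorem finiteDimensional_lp_countOn (A : Finset ℝ) :
    FiniteDimensional ℂ (Lp ℂ 2 (countOn A)) :=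
  LinearEquiv.finiteDimensional (lpCountOnEquiv A).symm

theorem IsSpectrum.linearIndependent {μ : Measure ℝ} [IsFiniteMeasure μ] {S : Set ℝ}
    (hS : IsSpectrum μ S) : LinearIndependent ℂ (fun l : S => expLp μ l) :=
  linearIndependent_of_ne_zero_of_inner_eq_zero (fun l => hS.ne_zero l l.2)
    fun l m h => hS.orthogonal l l.2 m m.2 (Subtype.coe_injective.ne h)

/-- The exponentials of a spectrum of `A` restrict to the rows of a Hadamard matrix on `A`. -/
theorem IsSpectralFinset.exists_hadamard {A : Finset ℝ} (hA : IsSpectralFinset A) :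
    ∃ f : A → ℝ, IsComplexHadamard (fun i a : A => expFun (f i) a) := by
  obtain ⟨S, hS⟩ := hA
  have := finiteDimensional_lp_countOn A
  have hspan : Submodule.span ℂ (Set.range fun l : S => expLp (countOn A) l) = ⊤ := by
    rw [← hS.dense_span, (Submodule.closed_of_finiteDimensional _).submodule_topologicalClosure_eq,
      Set.image_eq_range]
  let b := Module.Basis.mk hS.linearIndependent hspan.ge
  -- Any two bases have equivalent index sets; comparison with the point evaluations indexes the
  -- spectrum by `A`.
  let e : A ≃ S := ((Pi.basisFun ℂ A).map (lpCountOnEquiv A).symm).indexEquiv b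
  refine ⟨fun i => e i, IsComplexHadamard.of_row (fun i p => norm_expFun _ _) fun i k hik => ?_⟩
  have := hS.orthogonal (e i) (e i).2 (e k) (e k).2
    (Subtype.coe_injective.ne (e.injective.ne hik))
  rw [inner_expLp_countOn] at this
  rw [← this]
  exact Finset.sum_coe_sort A (fun a => expFun (e k) a / expFun (e i) a)

/-- A set of `|A|` frequencies with pairwise orthogonal exponentials is a spectrum. -/
theorem isSpectralFinset_of_orthogonal {A S : Finset ℝ} (hcard : S.card = A.card)
    (hS : ∀ l ∈ S, ∀ m ∈ S, l ≠ m → ∑ a ∈ A, expFun m a / expFun l a = 0) :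
    IsSpectralFinset A := by
  have := finiteDimensional_lp_countOn A
  have horth : ∀ l ∈ (S : Set ℝ), ∀ m ∈ (S : Set ℝ), l ≠ m →
      inner ℂ (expLp (countOn A) l) (expLp (countOn A) m) = 0 := fun l hl m hm hlm => by
    rw [inner_expLp_countOn, hS l hl m hm hlm]
  have hne : ∀ l ∈ (S : Set ℝ), expLp (countOn A) l ≠ 0 := fun l hl h => by
    have h1 := inner_expLp_countOn A l l
    have h2 : ∀ a, expFun l a / expFun l a = 1 := fun a => div_self (Complex.exp_ne_zero _)
    rw [h, inner_zero_left] at h1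
    simp only [h2, Finset.sum_const, nsmul_eq_mul, mul_one] at h1
    rw [← hcard, eq_comm, Nat.cast_eq_zero, Finset.card_eq_zero] at h1
    simp [h1] at hl
  have hli : LinearIndependent ℂ (fun l : S => expLp (countOn A) l) :=
    linearIndependent_of_ne_zero_of_inner_eq_zero (fun l => hne l l.2)
      fun l m h => horth l l.2 m m.2 (Subtype.coe_injective.ne h)
  have hspan := hli.span_eq_top_of_card_eq_finrank'
    (by rw [finrank_lp_countOn, Fintype.card_coe, hcard])
  refine ⟨S, hne, horth, ?_⟩
  rw [Set.image_eq_range]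
  exact (congrArg Submodule.topologicalClosure hspan).trans
    (IsClosed.submodule_topologicalClosure_eq isClosed_univ)

theorem expFun_pow (n : ℕ) (l x : ℝ) : expFun l x ^ n = expFun (n * l) x := by
  rw [expFun, expFun, ← Complex.exp_nat_mul]
  push_cast
  ring_nf

theorem expFun_sub_div (l m x : ℝ) : expFun m x / expFun l x = expFun (m - l) x := by
  rw [expFun, expFun, expFun, ← Complex.exp_sub]
  push_cast
  ring_nf

theorem expFun_eq_expFun_iff (l x y : ℝ) : expFun l x = expFun l y ↔ ∃ n : ℤ, l * x = l * y + n := by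
  rw [expFun, expFun, Complex.exp_eq_exp_iff_exists_int]
  refine exists_congr fun n => ?_
  have h : (2 * Real.pi * Complex.I : ℂ) ≠ 0 := Complex.two_pi_I_ne_zero
  rw [← Complex.ofReal_inj]
  push_cast
  constructor
  · intro h'
    exact mul_left_cancel₀ h (by linear_combination h')
  · intro h'
    linear_combination (2 * Real.pi * Complex.I : ℂ) * h'

/-- A spectral set of two, three or five numbers is mapped by some exponential onto roots of
unity. -/
theorem IsSpectralFinset.exists_frequency {N : ℕ} (hN : N = 2 ∨ N = 3 ∨ N = 5) {A : Finset ℝ}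
    (hcard : A.card = N) (hA : IsSpectralFinset A) :
    ∃ l : ℝ, ∀ a ∈ A, ∀ b ∈ A, expFun l a ^ N = expFun l b ^ N ∧
      (expFun l a = expFun l b → a = b) := by
  obtain ⟨f, hf⟩ := hA.exists_hadamard
  let e : Fin N ≃ A := (finCongr hcard.symm).trans A.equivFin.symm
  have hN2 : 2 ≤ N := by omega
  obtain ⟨h1, h2⟩ := (hf.reindex e e).ratio_pow_and_injective hN (k := ⟨0, by omega⟩)
    (m := ⟨1, by omega⟩) (by simp)
  simp only [expFun_sub_div] at h1 h2
  refine ⟨f (e ⟨1, by omega⟩) - f (e ⟨0, by omega⟩), fun a ha b hb => ⟨?_, fun h => ?_⟩⟩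
  · simpa using h1 (e.symm ⟨a, ha⟩) (e.symm ⟨b, hb⟩)
  · have := @h2 (e.symm ⟨a, ha⟩) (e.symm ⟨b, hb⟩) (by simpa using h)
    simpa using this

/-! ### Complete residue systems and integer sets -/

theorem isCompleteResidues_of_card {N : ℕ} [NeZero N] {C : Finset ℤ} (hcard : C.card = N)
    (hinj : ∀ a ∈ C, ∀ b ∈ C, (N : ℤ) ∣ a - b → a = b) : IsCompleteResidues N C := by
  have hinj' : Function.Injective (fun c : C => ((c : ℤ) : ZMod N)) := fun a b h =>
    Subtype.ext (hinj a a.2 b b.2 (Int.ModEq.dvd ((ZMod.intCast_eq_intCast_iff _ _ _).1 h.symm)))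
  have hbij := (Fintype.bijective_iff_injective_and_card _).2
    ⟨hinj', by rw [Fintype.card_coe, hcard, ZMod.card]⟩
  intro r
  obtain ⟨c, hc⟩ := hbij.2 (r : ZMod N)
  have hc' : (c : ℤ) ≡ r [ZMOD N] := (ZMod.intCast_eq_intCast_iff _ _ _).1 hc
  exact ⟨c, ⟨c.2, hc'⟩, fun d hd => hinj d hd.1 c c.2 ((hc'.trans hd.2.symm).dvd)⟩

theorem IsCompleteResidues.bijective {N : ℕ} {C : Finset ℤ} (hC : IsCompleteResidues N C) :
    Function.Bijective (fun c : C => ((c : ℤ) : ZMod N)) := by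
  constructor
  · intro a b h
    obtain ⟨c, -, hc⟩ := hC b
    have hab : (a : ℤ) ≡ b [ZMOD N] := (ZMod.intCast_eq_intCast_iff _ _ _).1 h
    exact Subtype.ext ((hc a ⟨a.2, hab⟩).trans (hc b ⟨b.2, Int.ModEq.refl _⟩).symm)
  · intro x
    obtain ⟨r, rfl⟩ := ZMod.intCast_surjective x
    obtain ⟨c, hc, -⟩ := hC r
    exact ⟨⟨c, hc.1⟩, (ZMod.intCast_eq_intCast_iff _ _ _).2 hc.2⟩

theorem IsCompleteResidues.sum_expFun {N : ℕ} [NeZero N] {C : Finset ℤ}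
    (hC : IsCompleteResidues N C) {j : ℤ} (hj : ¬ (N : ℤ) ∣ j) :
    ∑ c ∈ C, expFun (j / N) c = 0 := by
  have h1 : ∀ c : ℤ, expFun (j / N) c = ZMod.stdAddChar ((c : ZMod N) * (j : ZMod N)) := by
    intro c
    rw [← Int.cast_mul, ZMod.stdAddChar_coe, expFun]
    push_cast
    ring_nf
  have hj' : (j : ZMod N) ≠ 0 := by rwa [Ne, ZMod.intCast_zmod_eq_zero_iff_dvd]
  rw [← Finset.sum_coe_sort]
  simp only [h1]
  rw [hC.bijective.sum_comp (fun x : ZMod N => (ZMod.stdAddChar (x * (j : ZMod N)) : ℂ)),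
    AddChar.sum_mulShift _ (ZMod.isPrimitive_stdAddChar N), if_neg hj', Nat.cast_zero]

theorem IsCompleteResidues.isSpectralFinset {N : ℕ} [NeZero N] {C : Finset ℤ}
    (hC : IsCompleteResidues N C) (k : ℕ) :
    IsSpectralFinset (C.image (fun c : ℤ => (((N : ℤ) ^ k * c : ℤ) : ℝ))) := by
  have hN : (N : ℝ) ≠ 0 := NeZero.ne _
  have hNk : (N : ℝ) ^ k ≠ 0 := pow_ne_zero _ hN
  have hinj : Function.Injective (fun c : ℤ => (((N : ℤ) ^ k * c : ℤ) : ℝ)) := fun a b h => by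
    have h' : (N : ℝ) ^ k * a = (N : ℝ) ^ k * b := by simpa only [Int.cast_mul, Int.cast_pow,
      Int.cast_natCast] using h
    exact_mod_cast mul_left_cancel₀ hNk h'
  have hinj' : Function.Injective (fun j : ℕ => (j : ℝ) / N ^ (k + 1)) := fun a b h => by
    have h' := (div_left_inj' (pow_ne_zero (k + 1) hN)).1 h
    exact_mod_cast h'
  have hcard : C.card = N := by
    rw [← Fintype.card_coe, Fintype.card_of_bijective hC.bijective, ZMod.card]
  -- On `N ^ k * c` the difference of two such frequencies acts as `(j - i) / N` does on `c`, a
  -- nontrivial character modulo `N`.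
  refine isSpectralFinset_of_orthogonal (S := (Finset.range N).image fun j : ℕ =>
    (j : ℝ) / N ^ (k + 1)) ?_ ?_
  · rw [Finset.card_image_of_injective _ hinj, Finset.card_image_of_injective _ hinj',
      Finset.card_range, hcard]
  · intro l hl m hm hlm
    obtain ⟨i, hi, rfl⟩ := Finset.mem_image.1 hl
    obtain ⟨j, hj, rfl⟩ := Finset.mem_image.1 hm
    rw [Finset.mem_range] at hi hj
    rw [Finset.sum_image hinj.injOn]
    have hij : i ≠ j := fun h => hlm (by rw [h])
    have hdvd : ¬ (N : ℤ) ∣ (j : ℤ) - i := fun h => by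
      have := Int.eq_zero_of_abs_lt_dvd h (by rw [abs_lt]; omega)
      omega
    rw [← hC.sum_expFun hdvd]
    refine Finset.sum_congr rfl fun c _ => ?_
    rw [expFun_sub_div, expFun, expFun]
    congr 1
    have h2 : (N : ℂ) ≠ 0 := by exact_mod_cast hN
    push_cast
    field_simp
    ring

/-- If a multiple of `B` consists of integers that are distinct modulo the prime `N = |B|`, then
`B` is a complete set of residues up to a power of `N`. -/
theorem exists_completeResidues {N : ℕ} (hN : N.Prime) {B : Finset ℤ} (hcard : B.card = N) {t : ℝ}
    {m : ℤ → ℤ} (ht : ∀ b ∈ B, t * b = m b)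
    (hinj : ∀ a ∈ B, ∀ b ∈ B, (N : ℤ) ∣ m a - m b → a = b) :
    ∃ (k : ℕ) (C : Finset ℤ), IsCompleteResidues N C ∧
      B = C.image (fun c : ℤ => (N : ℤ) ^ k * c) := by
  have : NeZero N := ⟨hN.ne_zero⟩
  obtain ⟨b₀, hb₀, hb₀0⟩ : ∃ b ∈ B, b ≠ 0 :=
    Finset.exists_mem_ne (hcard.symm ▸ hN.one_lt) 0
  -- The factor `t` is rational. Its reduced denominator divides every element of `B`.
  set x : ℚ := m b₀ / b₀ with hx
  have hxt : (x : ℝ) = t := by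
    have : (b₀ : ℝ) ≠ 0 := by exact_mod_cast hb₀0
    rw [hx]
    push_cast
    rw [← ht b₀ hb₀, mul_div_cancel_right₀ _ this]
  have hden : (x.den : ℤ) ≠ 0 := by exact_mod_cast x.den_ne_zero
  have hnum : ∀ b ∈ B, x.num * b = x.den * m b := by
    intro b hb
    have h1 := ht b hb
    rw [← hxt] at h1
    have h2 : x * b = m b := by exact_mod_cast h1
    have h3 : (x.num : ℚ) * b = x.den * m b := by
      rw [← h2, ← Rat.mul_den_eq_num x]; ring
    exact_mod_cast h3
  have hcop : IsCoprime (x.den : ℤ) x.num := by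
    rw [Int.isCoprime_iff_gcd_eq_one, Int.gcd_comm]
    exact x.reduced
  have hdvd : ∀ b ∈ B, (x.den : ℤ) ∣ b := fun b hb =>
    hcop.dvd_of_dvd_mul_left ⟨m b, hnum b hb⟩
  obtain ⟨k, s, hs, hks⟩ := Nat.exists_eq_pow_mul_and_not_dvd x.den_ne_zero N hN.ne_one
  have hNk : ((N : ℤ) ^ k) ≠ 0 := pow_ne_zero _ (by exact_mod_cast hN.ne_zero)
  have hks' : (x.den : ℤ) = N ^ k * s := by exact_mod_cast hks
  have hB : ∀ b ∈ B, ∃ c, b = x.den * c ∧ m b = x.num * c := by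
    intro b hb
    obtain ⟨c, hc⟩ := hdvd b hb
    refine ⟨c, hc, mul_left_cancel₀ hden ?_⟩
    rw [← hnum b hb, hc]
    ring
  have himage : B = (B.image (fun b => b / (N : ℤ) ^ k)).image (fun c : ℤ => (N : ℤ) ^ k * c) := by
    rw [Finset.image_image]
    conv_lhs => rw [← Finset.image_id (s := B)]
    refine Finset.image_congr fun b hb => ?_
    exact (Int.mul_ediv_cancel' ((Dvd.intro _ hks'.symm).trans (hdvd b hb))).symm
  refine ⟨k, B.image (fun b => b / (N : ℤ) ^ k), isCompleteResidues_of_card ?_ ?_, himage⟩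
  · refine le_antisymm (Finset.card_image_le.trans_eq hcard) ?_
    conv_lhs => rw [← hcard, himage]
    exact Finset.card_image_le
  · intro a ha b hb hab
    obtain ⟨a, ha', rfl⟩ := Finset.mem_image.1 ha
    obtain ⟨b, hb', rfl⟩ := Finset.mem_image.1 hb
    obtain ⟨c, hc, hmc⟩ := hB a ha'
    obtain ⟨d, hd, hmd⟩ := hB b hb'
    -- The quotients are `s * c` with `N ∤ s`, so their congruence passes to `c` and then to `m =
    -- x.num * c`.
    have hdiv : ∀ y c : ℤ, y = x.den * c → y / (N : ℤ) ^ k = s * c := fun y c h => by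
      rw [h, hks', mul_assoc, Int.mul_ediv_cancel_left _ hNk]
    simp only [hdiv a c hc, hdiv b d hd, ← mul_sub] at hab
    have hcd := ((Nat.prime_iff_prime_int.1 hN).dvd_or_dvd hab).resolve_left
      (fun h => hs (by exact_mod_cast h))
    have := hinj a ha' b hb' (by rw [hmc, hmd, ← mul_sub]; exact hcd.mul_left _)
    rw [this]

theorem corollary1p15 (N : ℕ) (hN : N = 2 ∨ N = 3 ∨ N = 5) (B : Finset ℤ) (hcard : B.card = N)
    (h0 : (0 : ℤ) ∈ B) :
    IsSpectralFinset (B.image (fun b : ℤ => (b : ℝ))) ↔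
      ∃ (k : ℕ) (C : Finset ℤ), IsCompleteResidues N C ∧
        B = C.image (fun c : ℤ => (N : ℤ) ^ k * c) := by
  have hprime : N.Prime := by rcases hN with rfl | rfl | rfl <;> norm_num
  have : NeZero N := ⟨hprime.ne_zero⟩
  have hN0 : (N : ℝ) ≠ 0 := NeZero.ne _
  constructor
  · intro hB
    obtain ⟨l, hl⟩ := hB.exists_frequency hN
      (by rw [Finset.card_image_of_injective _ Int.cast_injective, hcard])
    have hl' : ∀ a ∈ B, ∀ b ∈ B, expFun l a ^ N = expFun l b ^ N ∧
        (expFun l a = expFun l b → a = b) := fun a ha b hb => by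
      obtain ⟨h1, h2⟩ := hl a (Finset.mem_image_of_mem _ ha) b (Finset.mem_image_of_mem _ hb)
      exact ⟨h1, fun h => by exact_mod_cast h2 h⟩
    have hm : ∀ b : ℤ, ∃ m : ℤ, b ∈ B → N * l * b = m := by
      intro b
      by_cases hb : b ∈ B
      -- Comparison with the point `0`, where every exponential is one, removes the common factor.
      · have h1 := (hl' b hb 0 h0).1
        rw [expFun_pow, expFun_pow, expFun_eq_expFun_iff] at h1
        obtain ⟨n, hn⟩ := h1
        exact ⟨n, fun _ => by simpa using hn⟩
      · exact ⟨0, fun h => absurd h hb⟩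
    choose m hm using hm
    refine exists_completeResidues hprime hcard hm fun a ha b hb hab => ?_
    obtain ⟨n, hn⟩ := hab
    refine (hl' a ha b hb).2 ((expFun_eq_expFun_iff _ _ _).2 ⟨n, mul_left_cancel₀ hN0 ?_⟩)
    have hn' : (m a : ℝ) - m b = N * n := by exact_mod_cast hn
    linear_combination hm a ha - hm b hb + hn'
  · rintro ⟨k, C, hC, rfl⟩
    rw [Finset.image_image]
    exact hC.isSpectralFinset k
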